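/- **Race-freedom of projected choreographies.** *Parameters.* Fix sets of roles, public and private operations, variables, values (containing $\mathit{true}\neq\mathit{false}$ and $\mathit{ok}$), expressions (including values and variables) and boolean expressions, both with total evaluation in a local state. Besides user operations $o$ there are auxiliary operations $o^*_n$ and extended operations $n{\cdot}o$ ($n\in\mathbb N$, $o$ a user operation); besides user variables there are auxiliary variables $x_n$ and $\_$. A global state $\Sigma$ gives every role $r$ a local state $\Sigma_r$. *Choreographies.* DIOC processes are $I ::= o:r_1(e)\to r_2(x)\ (r_1\ne r_2)\mid I;I'\mid I|I'\mid x@r=e\mid \mathbf 1\mid \mathbf 0\mid \mathtt{if}\,b@r\,\{I\}\,\mathtt{else}\,\{I'\}\mid \mathtt{while}\,b@r\,\{I\}\mid \mathtt{scope}\,@r\,\{I\}$, with user operations and variables. $I$ is *initial* if $\mathbf 0$ does not occur in it. It is *annotated* if each interaction, assignment, conditional, loop and scope carries an index in $\mathbb N$, and *well-annotated* if these indexes are distinct. $\mathrm{roles}(I)$ is the set of roles occurring in $I$; $\mathrm{ops}(I)$ is the set of all $(o,r_1,r_2)$ with an interaction $o:r_1(e)\to r_2(x)$ in $I$. The sets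 of pairs $\mathrm{transI}(I)$, $\mathrm{transF}(I)$ are: both $\{(r_1,r_2)\}$ for an interaction, $\{(r,r)\}$ for an assignment at $r$, $\emptyset$ for $\mathbf 1,\mathbf 0$, the union for $I|I'$; $\mathrm{transI}(I;I')$ is $\mathrm{transI}(I)$ unless this is empty, then $\mathrm{transI}(I')$, and $\mathrm{transF}(I;I')$ is $\mathrm{transF}(I')$ unless this is empty, then $\mathrm{transF}(I)$; $\mathrm{transI}=\{(r,r)\}$ for conditionals, loops and scopes of $r$; $\mathrm{transF}$ of a conditional or loop of $r$ is the union of the $\mathrm{transF}$ of its bodies, or $\{(r,r)\}$ if this is empty; $\mathrm{transF}(\mathtt{scope}\,@r\{I\})$ is $\{(r',r): r'\in\mathrm{roles}(I)\setminus\{r\}\}$, or $\{(r,r)\}$ if this is empty. $I$ is *connected* if for each subterm $I';I''$, all $(r_1,r_2)\in\mathrm{transF}(I')$ and $(s_1,s_2)\in\mathrm{transI}(I'')$ satisfy $\{r_1,r_2\}\cap\{s_1,s_2\}\ne\emptyset$, and for each subterm $I'|I''$, $\mathrm{ops}(I')\cap\mathrm{ops}(I'')=\emptyset$. *Processes.*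 DPOC processes $P$ are built from receives $o:x\ \mathtt{from}\ r$, sends $o:e\ \mathtt{to}\ r$, higher-order sends $o:X\ \mathtt{to}\ r$ ($X$ a process or the token $\mathtt{no}$), $P;P'$, $P|P'$, $x=e$, conditionals, loops, $\mathbf 1$, $\mathbf 0$, coordinator scopes $n:\mathtt{scope}\,@r\{P\}\,\mathtt{roles}\,S$, and scopes $n:\mathtt{scope}\,@r\{P\}$ of non-coordinating roles. A network is a parallel composition of roles $(P,\Gamma)_r$ (process $P$, local state $\Gamma$) with different names. *Projection.* For an annotated $I$ and a role $s$, $\pi(I,s)$ commutes with $;$, $|$, $\mathbf 1$, $\mathbf 0$, and equals $\mathbf 1$ when $s$ does not take part in the construct; otherwise: an interaction gives $o:e\ \mathtt{to}\ r_2$ for $s=r_1$ and $o:x\ \mathtt{from}\ r_1$ for $s=r_2$; an assignment at $s$ gives $x=e$. For $n:\mathtt{if}\,b@r\{I\}\mathtt{else}\{I'\}$ with $R=(\mathrm{roles}(I)\cup\mathrm{roles}(I'))\setminus\{r\}$: $\mathtt{if}\,b\{\Pi_{r'\in R}\,o^*_n:\mathit{true}\ \mathtt{to}\ r';\pi(I,r)\}\mathtt{else}\{\Pi_{r'\in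 R}\,o^*_n:\mathit{false}\ \mathtt{to}\ r';\pi(I',r)\}$ for $s=r$, and $o^*_n:x_n\ \mathtt{from}\ r;\ \mathtt{if}\,x_n\{\pi(I,s)\}\mathtt{else}\{\pi(I',s)\}$ for $s\in R$. For $n:\mathtt{while}\,b@r\{I\}$ with $R=\mathrm{roles}(I)\setminus\{r\}$: $\mathtt{while}\,b\{\Pi_{r'\in R}\,o^*_n:\mathit{true}\ \mathtt{to}\ r';\pi(I,r);\Pi_{r'\in R}\,o^*_n:\_\ \mathtt{from}\ r'\};\Pi_{r'\in R}\,o^*_n:\mathit{false}\ \mathtt{to}\ r'$ for $s=r$, and $o^*_n:x_n\ \mathtt{from}\ r;\mathtt{while}\,x_n\{\pi(I,s);o^*_n:\mathit{ok}\ \mathtt{to}\ r;o^*_n:x_n\ \mathtt{from}\ r\}$ for $s\in R$. For $n:\mathtt{scope}\,@r\{I\}$: $n:\mathtt{scope}\,@r\{\pi(I,r)\}\,\mathtt{roles}\,\mathrm{roles}(I)$ for $s=r$, and $n:\mathtt{scope}\,@r\{\pi(I,s)\}$ for $s\in\mathrm{roles}(I)\setminus\{r\}$. The projection $\mathrm{proj}(I,\Sigma)$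 is the parallel composition of the roles $(\pi(I,s),\Sigma_s)_s$, $s\in\mathrm{roles}(I)$. *Semantics.* A DPOC system $\langle\mathbf I,N\rangle$ is a network $N$ with a set $\mathbf I$ of (plain) DIOC processes, the available updates. Roles evolve by the usual rules: $\mathbf 1$ terminates with label $\surd$, becoming $\mathbf 0$; $P;Q$ acts as $P$, or as $Q$ if $P$ can do $\surd$; parallel components interleave and synchronise on $\surd$; a send becomes $\mathbf 1$; a receive in $x$ of value $v$ becomes $x=v$; assignments, conditionals and loops are silent steps. A coordinator scope $n:\mathtt{scope}\,@r\{P\}\,\mathtt{roles}\,S$ either becomes $\Pi_{s\in S\setminus\{r\}}\,o^*_n:\mathtt{no}\ \mathtt{to}\ s;\,P;\,\Pi_{s\in S\setminus\{r\}}\,o^*_n:\_\ \mathtt{from}\ s$, or is updated: for a connected $J\in\mathbf I$ with $\mathrm{roles}(J)\subseteq S$, it becomes $\Pi_{s\in S\setminus\{r\}}\,o^*_n:\pi(J',s)\ \mathtt{to}\ s;\,\pi(J',r);\,\Pi_{s\in S\setminus\{r\}}\,o^*_n:\_\ \mathtt{from}\ s$, where $J'$ is $J$ annotated with distinct indexes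 that occur nowhere in the network, and with each operation $o$ renamed to $n{\cdot}o$. The scope $n:\mathtt{scope}\,@r\{P\}$ of another role receives on $o^*_n$ from $r$ a process $P'$ or $\mathtt{no}$, and becomes $P';o^*_n:\mathit{ok}\ \mathtt{to}\ r$ or $P;o^*_n:\mathit{ok}\ \mathtt{to}\ r$ respectively. In a network, an enabled send in role $r_1$ to $r_2\neq r_1$ and an enabled receive in $r_2$ from $r_1$ on the same operation (both of values, or both of higher-order messages) synchronise; roles otherwise move independently, and $\surd$ is performed jointly. The set $\mathbf I$ may change to any other set at any time. Sends and receives that are not part of a synchronisation are not transitions of a computation. *Claim.* Let $I$ be an initial, connected DIOC process, annotated in any way that makes it well-annotated, let $\Sigma$ be a global state and $\mathbf I$ a set of updates. If $\langle\mathbf I,\mathrm{proj}(I,\Sigma)\rangle\xrightarrow{\mu_1}\cdots\xrightarrow{\mu_n}\langle\mathbf I',N\rangle$ with $n\ge 0$, then in $N$ two distinct send occurrences cannot both interact with the same receive occurrence, and two distinct receive occurrences cannot both interact with the same send occurrence. Here occurrences are positions in the processes of the roles, a send and a receive occurrence can interact if both are enabled and can be synchronised as above, sends include higher-order sends, and receives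 include the scopes of non-coordinating roles (which receive higher-order messages). -/

import Mathlib

namespace DynChor

universe u

/-- The parameters of the calculus: roles, public and private operations, variables, values,
expressions (including at least values and variables) and boolean expressions, with their total
evaluation in a local state.  The values contain `true`, `false` and the acknowledgement `ok`. -/
structure Sig where
  Role : Type u
  [decRole : DecidableEq Role]
  PublicOp : Type u
  PrivateOp : Type u
  Var : Type u
  Val : Type u
  Expr : Type u
  BExpr : Type u
  val : Val → Expr
  var : Var → Expr
  exprVal : Expr → (Var → Val) → Val
  boolVal : BExpr → (Var → Val) → Bool
  eval_val : ∀ v γ, exprVal (val v) γ = v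
  eval_var : ∀ x γ, exprVal (var x) γ = γ x
  tt : Val
  ff : Val
  ok : Val
  tt_ne_ff : tt ≠ ff

attribute [instance] Sig.decRole

/-- The operations that may occur in a choreography: public or private. -/
inductive UserOp (S : Sig.{u}) : Type u
  | pub (o : S.PublicOp)
  | priv (o : S.PrivateOp)

/-- All operations of the process level: those of the choreography, the (private) auxiliary
operations `o*_n`, and the extended operations `n·o` used in the code of updates. -/
inductive Op (S : Sig.{u}) : Type u
  | user (o : UserOp S)
  | aux (n : ℕ)
  | ext (n : ℕ) (o : UserOp S)

/-- All variables of the process level: those of the choreography, the auxiliary variables `x_n`,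
and the variable `_`. -/
inductive PVar (S : Sig.{u}) : Type u
  | user (x : S.Var)
  | guard (n : ℕ)
  | dummy

/-! ### Choreographies (DIOC processes) -/

/-- DIOC processes with operations in `O`; interactions, assignments, conditionals, loops and scopes
carry an annotation in `A`. -/
inductive Dioc (S : Sig.{u}) (O : Type u) (A : Type) : Type u
  | comm (a : A) (o : O) (r₁ : S.Role) (e : S.Expr) (r₂ : S.Role) (x : S.Var) (h : r₁ ≠ r₂)
  | seq (I J : Dioc S O A)
  | par (I J : Dioc S O A)
  | assign (a : A) (x : S.Var) (r : S.Role) (e : S.Expr)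
  | one
  | zero
  | ite (a : A) (b : S.BExpr) (r : S.Role) (I J : Dioc S O A)
  | while (a : A) (b : S.BExpr) (r : S.Role) (I : Dioc S O A)
  | scope (a : A) (r : S.Role) (I : Dioc S O A)

/-- Plain (not annotated) DIOC processes. -/
abbrev Choreo (S : Sig.{u}) : Type u := Dioc S (UserOp S) Unit

/-- DIOC processes annotated with indexes. -/
abbrev AnnChoreo (S : Sig.{u}) : Type u := Dioc S (UserOp S) ℕ

namespace Dioc

variable {S : Sig.{u}} {O O' : Type u} {A A' : Type}

/-- Rename operations and annotations. -/
def map (f : O → O') (g : A → A') : Dioc S O A → Dioc S O' A'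
  | comm a o r₁ e r₂ x h => comm (g a) (f o) r₁ e r₂ x h
  | seq I J => seq (map f g I) (map f g J)
  | par I J => par (map f g I) (map f g J)
  | assign a x r e => assign (g a) x r e
  | one => one
  | zero => zero
  | ite a b r I J => ite (g a) b r (map f g I) (map f g J)
  | .while a b r I => .while (g a) b r (map f g I)
  | scope a r I => scope (g a) r (map f g I)

/-- Forget the annotations. -/
def erase (I : Dioc S O A) : Dioc S O Unit := I.map id (fun _ => ())

/-- The annotations of a process, with repetitions. -/
def annotations : Dioc S O A → List A
  | comm a _ _ _ _ _ _ => [a]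
  | seq I J => annotations I ++ annotations J
  | par I J => annotations I ++ annotations J
  | assign a _ _ _ => [a]
  | one => []
  | zero => []
  | ite a _ _ I J => a :: (annotations I ++ annotations J)
  | .while a _ _ I => a :: annotations I
  | scope a _ I => a :: annotations I

/-- All indexes are distinct. -/
def WellAnnotated (I : Dioc S O ℕ) : Prop := I.annotations.Nodup

/-- The terminated process `0` never occurs. -/
def Initial : Dioc S O A → Prop
  | comm _ _ _ _ _ _ _ => True
  | seq I J => Initial I ∧ Initial J
  | par I J => Initial I ∧ Initial J
  | assign _ _ _ _ => True
  | one => True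
  | zero => False
  | ite _ _ _ I J => Initial I ∧ Initial J
  | .while _ _ _ I => Initial I
  | scope _ _ I => Initial I

def roles : Dioc S O A → Finset S.Role
  | comm _ _ r₁ _ r₂ _ _ => {r₁, r₂}
  | seq I J => roles I ∪ roles J
  | par I J => roles I ∪ roles J
  | assign _ _ r _ => {r}
  | one => ∅
  | zero => ∅
  | ite _ _ r I J => {r} ∪ (roles I ∪ roles J)
  | .while _ _ r I => {r} ∪ roles I
  | scope _ r I => {r} ∪ roles I

/-- The signatures `o : r₁ → r₂` of the interactions. -/
def operations : Dioc S O A → Set (O × S.Role × S.Role)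
  | comm _ o r₁ _ r₂ _ _ => {(o, r₁, r₂)}
  | seq I J => operations I ∪ operations J
  | par I J => operations I ∪ operations J
  | assign _ _ _ _ => ∅
  | one => ∅
  | zero => ∅
  | ite _ _ _ I J => operations I ∪ operations J
  | .while _ _ _ I => operations I
  | scope _ _ I => operations I

/-- Senders and receivers of the possible initial interactions. -/
def transI : Dioc S O A → Finset (S.Role × S.Role)
  | comm _ _ r₁ _ r₂ _ _ => {(r₁, r₂)}
  | seq I J => if transI I = ∅ then transI J else transI I
  | par I J => transI I ∪ transI J
  | assign _ _ r _ => {(r, r)}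
  | one => ∅
  | zero => ∅
  | ite _ _ r _ _ => {(r, r)}
  | .while _ _ r _ => {(r, r)}
  | scope _ r _ => {(r, r)}

/-- Senders and receivers of the possible final interactions. -/
def transF : Dioc S O A → Finset (S.Role × S.Role)
  | comm _ _ r₁ _ r₂ _ _ => {(r₁, r₂)}
  | seq I J => if transF J = ∅ then transF I else transF J
  | par I J => transF I ∪ transF J
  | assign _ _ r _ => {(r, r)}
  | one => ∅
  | zero => ∅
  | ite _ _ r I J => if transF I ∪ transF J = ∅ then {(r, r)} else transF I ∪ transF J
  | .while _ _ r I => if transF I = ∅ then {(r, r)} else transF I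
  | scope _ r I => if roles I ⊆ {r} then {(r, r)} else (roles I \ {r}).image fun r' => (r', r)

/-- Connectedness for sequence (at every sequential composition) and for parallel (at every parallel
composition). -/
def Connected : Dioc S O A → Prop
  | comm _ _ _ _ _ _ _ => True
  | seq I J => Connected I ∧ Connected J ∧
      ∀ p ∈ transF I, ∀ q ∈ transI J,
        (({p.1, p.2} : Finset S.Role) ∩ {q.1, q.2}).Nonempty
  | par I J => Connected I ∧ Connected J ∧ operations I ∩ operations J = ∅
  | assign _ _ _ _ => True
  | one => True
  | zero => True
  | ite _ _ _ I J => Connected I ∧ Connected J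
  | .while _ _ _ I => Connected I
  | scope _ _ I => Connected I

end Dioc

/-! ### DPOC processes -/

/-- Guards of conditionals and loops: a boolean expression, or an auxiliary variable `x_n`. -/
inductive Guard (S : Sig.{u}) : Type u
  | user (b : S.BExpr)
  | var (n : ℕ)

/-- DPOC processes.  The higher-order send has two forms: `sendProc` sends the code of a process,
`sendNo` sends the token `no`.  `scopeLead n r P R` is the scope of the coordinator `r`, with the set
`R` of involved roles; `scopeFollow n r P` is the scope of another role, with coordinator `r`. -/
inductive Proc (S : Sig.{u}) : Type u
  | recv (o : Op S) (x : PVar S) (r : S.Role)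
  | send (o : Op S) (e : S.Expr) (r : S.Role)
  | sendProc (o : Op S) (X : Proc S) (r : S.Role)
  | sendNo (o : Op S) (r : S.Role)
  | seq (P Q : Proc S)
  | par (P Q : Proc S)
  | assign (x : PVar S) (e : S.Expr)
  | while (b : Guard S) (P : Proc S)
  | ite (b : Guard S) (P Q : Proc S)
  | scopeLead (n : ℕ) (r : S.Role) (P : Proc S) (R : Finset S.Role)
  | scopeFollow (n : ℕ) (r : S.Role) (P : Proc S)
  | one
  | zero

/-- Local states. -/
abbrev Store (S : Sig.{u}) : Type u := PVar S → S.Val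

/-- Global states. -/
abbrev GlobalState (S : Sig.{u}) : Type u := S.Role → Store S

section

variable {S : Sig.{u}}

open Classical in
/-- The local state `Γ[v/x]`. -/
noncomputable def Store.set (Γ : Store S) (x : PVar S) (v : S.Val) : Store S :=
  fun y => if y = x then v else Γ y

/-- Evaluation of an expression; expressions mention no auxiliary variables. -/
def Store.expr (Γ : Store S) (e : S.Expr) : S.Val := S.exprVal e fun x => Γ (.user x)

open Classical in
/-- Evaluation of a guard. -/
noncomputable def Store.guard (Γ : Store S) : Guard S → Bool
  | .user b => S.boolVal b fun x => Γ (.user x)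
  | .var n => decide (Γ (.guard n) = S.tt)

/-- The index in the name of an auxiliary or extended operation. -/
def Op.indexes : Op S → Set ℕ
  | .user _ => ∅
  | .aux n => {n}
  | .ext n _ => {n}

def PVar.indexes : PVar S → Set ℕ
  | .user _ => ∅
  | .guard n => {n}
  | .dummy => ∅

def Guard.indexes : Guard S → Set ℕ
  | .user _ => ∅
  | .var n => {n}

namespace Proc

/-- All the indexes that occur in a process. -/
def indexes : Proc S → Set ℕ
  | recv o x _ => o.indexes ∪ x.indexes
  | send o _ _ => o.indexes
  | sendProc o X _ => o.indexes ∪ indexes X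
  | sendNo o _ => o.indexes
  | seq P Q => indexes P ∪ indexes Q
  | par P Q => indexes P ∪ indexes Q
  | assign x _ => x.indexes
  | .while b P => b.indexes ∪ indexes P
  | ite b P Q => b.indexes ∪ indexes P ∪ indexes Q
  | scopeLead n _ P _ => {n} ∪ indexes P
  | scopeFollow n _ P => {n} ∪ indexes P
  | one => ∅
  | zero => ∅

/-- Parallel composition of a list of processes; `1` if the list is empty. -/
def parList : List (Proc S) → Proc S
  | [] => one
  | [P] => P
  | P :: Q :: L => par P (parList (Q :: L))

/-- The parallel composition `Π_{r ∈ R} P r`. -/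
noncomputable def prod (R : Finset S.Role) (P : S.Role → Proc S) : Proc S :=
  parList (R.toList.map P)

end Proc

/-- The process-projection `π(I, s)` of an annotated process on the role `s`. -/
noncomputable def projRole : Dioc S (Op S) ℕ → S.Role → Proc S
  | .comm _ o r₁ e r₂ x _, s =>
      if s = r₁ then .send o e r₂
      else if s = r₂ then .recv o (.user x) r₁
      else .one
  | .seq I J, s => .seq (projRole I s) (projRole J s)
  | .par I J, s => .par (projRole I s) (projRole J s)
  | .assign _ x r e, s => if s = r then .assign (.user x) e else .one
  | .one, _ => .one
  | .zero, _ => .zero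
  | .ite n b r I J, s =>
      if s = r then
        .ite (.user b)
          (.seq (Proc.prod ((I.roles ∪ J.roles) \ {r}) fun r' => .send (.aux n) (S.val S.tt) r')
            (projRole I s))
          (.seq (Proc.prod ((I.roles ∪ J.roles) \ {r}) fun r' => .send (.aux n) (S.val S.ff) r')
            (projRole J s))
      else if s ∈ (I.roles ∪ J.roles) \ {r} then
        .seq (.recv (.aux n) (.guard n) r) (.ite (.var n) (projRole I s) (projRole J s))
      else .one
  | .while n b r I, s =>
      if s = r then
        .seq
          (.while (.user b)
            (.seq (Proc.prod (I.roles \ {r}) fun r' => .send (.aux n) (S.val S.tt) r')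
              (.seq (projRole I s)
                (Proc.prod (I.roles \ {r}) fun r' => .recv (.aux n) .dummy r'))))
          (Proc.prod (I.roles \ {r}) fun r' => .send (.aux n) (S.val S.ff) r')
      else if s ∈ I.roles \ {r} then
        .seq (.recv (.aux n) (.guard n) r)
          (.while (.var n)
            (.seq (projRole I s)
              (.seq (.send (.aux n) (S.val S.ok) r) (.recv (.aux n) (.guard n) r))))
      else .one
  | .scope n r I, s =>
      if s = r then .scopeLead n r (projRole I s) I.roles
      else if s ∈ I.roles \ {r} then .scopeFollow n r (projRole I s)
      else .one

/-- The code of role `s` for the update `J` (already annotated) applied to the scope with index `n`: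
every operation `o` of `J` is renamed to `n·o`. -/
noncomputable def projUpdate (n : ℕ) (J : AnnChoreo S) (s : S.Role) : Proc S :=
  projRole (J.map (Op.ext n) id) s

/-! ### Semantics of DPOC roles -/

/-- Labels of DPOC roles and systems.  `send r₁ o v r₂` and `recv r₂ o x v r₁` are performed by the
role mentioned first.  A higher-order message is the code of a process, or `no` (`none`).
The label of an update carries the update, with the indexes that were chosen for it. -/
inductive Label (S : Sig.{u}) : Type u
  | tau
  | tick
  | noUp
  | update (J : AnnChoreo S)
  | send (r₁ : S.Role) (o : Op S) (v : S.Val) (r₂ : S.Role)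
  | recv (r₂ : S.Role) (o : Op S) (x : PVar S) (v : S.Val) (r₁ : S.Role)
  | sendHO (r₁ : S.Role) (o : Op S) (X : Option (Proc S)) (r₂ : S.Role)
  | recvHO (r₂ : S.Role) (o : Op S) (X : Option (Proc S)) (r₁ : S.Role)
  | comm (o : Op S) (r₁ : S.Role) (v : S.Val) (r₂ : S.Role) (x : PVar S)
  | commHO (o : Op S) (r₁ : S.Role) (X : Option (Proc S)) (r₂ : S.Role)
  | changeUpdates (U : Set (Choreo S))

/-- The labels that may occur in a trace: all but the sends and receives that are not part of an
interaction. -/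
def Label.IsTraceLabel : Label S → Prop
  | .send _ _ _ _ => False
  | .recv _ _ _ _ _ => False
  | .sendHO _ _ _ _ => False
  | .recvHO _ _ _ _ => False
  | _ => True

/-- `RoleStep r P Γ δ P' Γ'`: the DPOC role `(P, Γ)_r` makes a transition labelled `δ` to
`(P', Γ')_r`. -/
inductive RoleStep (r : S.Role) : Proc S → Store S → Label S → Proc S → Store S → Prop
  | one (Γ : Store S) : RoleStep r .one Γ .tick .zero Γ
  | assign (x : PVar S) (e : S.Expr) (Γ : Store S) :
      RoleStep r (.assign x e) Γ .tau .one (Γ.set x (Γ.expr e))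
  | sendProc (o : Op S) (X : Proc S) (r' : S.Role) (Γ : Store S) :
      RoleStep r (.sendProc o X r') Γ (.sendHO r o (some X) r') .one Γ
  | sendNo (o : Op S) (r' : S.Role) (Γ : Store S) :
      RoleStep r (.sendNo o r') Γ (.sendHO r o none r') .one Γ
  | recv (o : Op S) (x : PVar S) (r' : S.Role) (v : S.Val) (Γ : Store S) :
      RoleStep r (.recv o x r') Γ (.recv r o x v r') (.assign x (S.val v)) Γ
  | send (o : Op S) (e : S.Expr) (r' : S.Role) (Γ : Store S) :
      RoleStep r (.send o e r') Γ (.send r o (Γ.expr e) r') .one Γ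
  | seq {P P' Q : Proc S} {Γ Γ' : Store S} {δ : Label S} :
      RoleStep r P Γ δ P' Γ' → δ ≠ .tick → RoleStep r (.seq P Q) Γ δ (.seq P' Q) Γ'
  | seqEnd {P P' Q Q' : Proc S} {Γ Γ' : Store S} {δ : Label S} :
      RoleStep r P Γ .tick P' Γ → RoleStep r Q Γ δ Q' Γ' → RoleStep r (.seq P Q) Γ δ Q' Γ'
  | parLeft {P P' Q : Proc S} {Γ Γ' : Store S} {δ : Label S} :
      RoleStep r P Γ δ P' Γ' → δ ≠ .tick → RoleStep r (.par P Q) Γ δ (.par P' Q) Γ'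
  | parRight {P Q Q' : Proc S} {Γ Γ' : Store S} {δ : Label S} :
      RoleStep r Q Γ δ Q' Γ' → δ ≠ .tick → RoleStep r (.par P Q) Γ δ (.par P Q') Γ'
  | parEnd {P P' Q Q' : Proc S} {Γ : Store S} :
      RoleStep r P Γ .tick P' Γ → RoleStep r Q Γ .tick Q' Γ →
        RoleStep r (.par P Q) Γ .tick (.par P' Q') Γ
  | ifThen {b : Guard S} {P Q : Proc S} {Γ : Store S} :
      Γ.guard b = true → RoleStep r (.ite b P Q) Γ .tau P Γ
  | ifElse {b : Guard S} {P Q : Proc S} {Γ : Store S} :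
      Γ.guard b = false → RoleStep r (.ite b P Q) Γ .tau Q Γ
  | whileUnfold {b : Guard S} {P : Proc S} {Γ : Store S} :
      Γ.guard b = true → RoleStep r (.while b P) Γ .tau (.seq P (.while b P)) Γ
  | whileExit {b : Guard S} {P : Proc S} {Γ : Store S} :
      Γ.guard b = false → RoleStep r (.while b P) Γ .tau .one Γ
  | leadUp {n : ℕ} {P : Proc S} {R : Finset S.Role} {Γ : Store S} {J : AnnChoreo S} :
      J.WellAnnotated → J.roles ⊆ R →
        RoleStep r (.scopeLead n r P R) Γ (.update J)
          (.seq (Proc.prod (R \ {r}) fun s => .sendProc (.aux n) (projUpdate n J s) s)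
            (.seq (projUpdate n J r) (Proc.prod (R \ {r}) fun s => .recv (.aux n) .dummy s))) Γ
  | leadNoUp {n : ℕ} {P : Proc S} {R : Finset S.Role} {Γ : Store S} :
      RoleStep r (.scopeLead n r P R) Γ .noUp
        (.seq (Proc.prod (R \ {r}) fun s => .sendNo (.aux n) s)
          (.seq P (Proc.prod (R \ {r}) fun s => .recv (.aux n) .dummy s))) Γ
  | up {n : ℕ} {r' : S.Role} {P X : Proc S} {Γ : Store S} :
      RoleStep r (.scopeFollow n r' P) Γ (.recvHO r (.aux n) (some X) r')
        (.seq X (.send (.aux n) (S.val S.ok) r')) Γ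
  | noUp {n : ℕ} {r' : S.Role} {P : Proc S} {Γ : Store S} :
      RoleStep r (.scopeFollow n r' P) Γ (.recvHO r (.aux n) none r')
        (.seq P (.send (.aux n) (S.val S.ok) r')) Γ

/-! ### Networks and DPOC systems -/

end

/-- Networks: parallel compositions of DPOC roles with different names, as partial functions from
role names (so that parallel composition is commutative and associative). -/
def Net (S : Sig.{u}) : Type u := S.Role → Option (Proc S × Store S)

section

variable {S : Sig.{u}}

namespace Net

/-- The network `(P, Γ)_r`. -/
def single (r : S.Role) (P : Proc S) (Γ : Store S) : Net S :=
  fun s => if s = r then some (P, Γ) else none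

/-- The role names of the two networks are different. -/
def Disjoint (N M : Net S) : Prop := ∀ r, N r = none ∨ M r = none

/-- Parallel composition (of networks with different role names). -/
def par (N M : Net S) : Net S := fun r => (N r).or (M r)

/-- The index `n` occurs in no process of the network. -/
def FreshIndex (N : Net S) (n : ℕ) : Prop := ∀ r P Γ, N r = some (P, Γ) → n ∉ P.indexes

/-- The indexes chosen for an update occur nowhere in the network. -/
def FreshFor (N : Net S) (J : AnnChoreo S) : Prop := ∀ n ∈ J.annotations, N.FreshIndex n

end Net

/-- The projection `proj(I, Σ)`: the parallel composition of the roles `(π(I, s), Σ_s)_s` for `s` in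
`roles(I)`. -/
noncomputable def proj (I : AnnChoreo S) (G : GlobalState S) : Net S :=
  fun s => if s ∈ I.roles then some (projRole (I.map Op.user id) s, G s) else none

/-- `Step U N η U' N'`: the DPOC system `⟨U, N⟩` makes a transition labelled `η` to `⟨U', N'⟩`.
When an update is applied, the indexes chosen for it have to be fresh for the whole network, which is
checked in `liftUp` and `extParallel`. The symmetric rules for parallel composition are instances
of the rules below, as parallel composition is commutative. -/
inductive Step : Set (Choreo S) → Net S → Label S → Set (Choreo S) → Net S → Prop
  | lift {U : Set (Choreo S)} {r : S.Role} {P P' : Proc S} {Γ Γ' : Store S} {δ : Label S} :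
      RoleStep r P Γ δ P' Γ' → (∀ J, δ ≠ .update J) →
        Step U (Net.single r P Γ) δ U (Net.single r P' Γ')
  | liftUp {U : Set (Choreo S)} {r : S.Role} {P P' : Proc S} {Γ Γ' : Store S}
      {J : AnnChoreo S} :
      RoleStep r P Γ (.update J) P' Γ' → J.erase.Connected → J.erase ∈ U →
        (Net.single r P Γ).FreshFor J →
        Step U (Net.single r P Γ) (.update J) U (Net.single r P' Γ')
  | changeUpdates (U U' : Set (Choreo S)) (N : Net S) : Step U N (.changeUpdates U') U' N
  | synch {U : Set (Choreo S)} {N N' M M' : Net S} {o : Op S} {r₁ r₂ : S.Role} {v : S.Val}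
      {x : PVar S} :
      Step U N (.send r₁ o v r₂) U N' → Step U M (.recv r₂ o x v r₁) U M' → N.Disjoint M →
        Step U (N.par M) (.comm o r₁ v r₂ x) U (N'.par M')
  | synchUp {U : Set (Choreo S)} {N N' M M' : Net S} {o : Op S} {r₁ r₂ : S.Role}
      {X : Option (Proc S)} :
      Step U N (.sendHO r₁ o X r₂) U N' → Step U M (.recvHO r₂ o X r₁) U M' → N.Disjoint M →
        Step U (N.par M) (.commHO o r₁ X r₂) U (N'.par M')
  | extParallel {U : Set (Choreo S)} {N N' M : Net S} {η : Label S} :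
      Step U N η U N' → η ≠ .tick → N.Disjoint M → (∀ J, η = .update J → M.FreshFor J) →
        Step U (N.par M) η U (N'.par M)
  | extParEnd {U : Set (Choreo S)} {N N' M M' : Net S} :
      Step U N .tick U N' → Step U M .tick U M' → N.Disjoint M →
        Step U (N.par M) .tick U (N'.par M')

/-- `⟨U', N'⟩` is reached from `⟨U, N⟩` by zero or more transitions with trace labels. -/
def Reaches (U : Set (Choreo S)) (N : Net S) (U' : Set (Choreo S)) (N' : Net S) : Prop :=
  Relation.ReflTransGen
    (fun A B : Set (Choreo S) × Net S =>
      ∃ η : Label S, η.IsTraceLabel ∧ Step A.1 A.2 η B.1 B.2)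
    (U, N) (U', N')

/-! ### Races -/

/-- The two sides of a sequential or parallel composition. -/
inductive Side
  | left
  | right

/-- `Active r Γ P p Q`: the occurrence of `Q` at position `p` of `P` is in evaluation position, that
is, `P` can execute the next action of this occurrence of `Q` in the role `r` with local state `Γ`. -/
inductive Active (r : S.Role) (Γ : Store S) : Proc S → List Side → Proc S → Prop
  | here (P : Proc S) : Active r Γ P [] P
  | seqLeft {P Q R : Proc S} {p : List Side} :
      Active r Γ P p R → Active r Γ (.seq P Q) (.left :: p) R
  | seqRight {P P' Q R : Proc S} {p : List Side} :
      RoleStep r P Γ .tick P' Γ → Active r Γ Q p R → Active r Γ (.seq P Q) (.right :: p) R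
  | parLeft {P Q R : Proc S} {p : List Side} :
      Active r Γ P p R → Active r Γ (.par P Q) (.left :: p) R
  | parRight {P Q R : Proc S} {p : List Side} :
      Active r Γ Q p R → Active r Γ (.par P Q) (.right :: p) R

/-- `Complementary r₁ r₂ A B`: the send `A` of role `r₁` and the receive `B` of role `r₂` fit together.
The receive of a higher-order message is performed by the scope of a role that is not the
coordinator. -/
inductive Complementary (r₁ r₂ : S.Role) : Proc S → Proc S → Prop
  | value (o : Op S) (e : S.Expr) (x : PVar S) :
      Complementary r₁ r₂ (.send o e r₂) (.recv o x r₁)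
  | code (n : ℕ) (X P : Proc S) :
      Complementary r₁ r₂ (.sendProc (.aux n) X r₂) (.scopeFollow n r₁ P)
  | no (n : ℕ) (P : Proc S) :
      Complementary r₁ r₂ (.sendNo (.aux n) r₂) (.scopeFollow n r₁ P)

/-- In the network `N`, the send that occurs at position `p` of role `r₁` can interact with the
receive that occurs at position `q` of role `r₂`. -/
def Net.CanInteract (N : Net S) (r₁ : S.Role) (p : List Side) (r₂ : S.Role) (q : List Side) : Prop :=
  r₁ ≠ r₂ ∧ ∃ P₁ Γ₁ P₂ Γ₂ A B, N r₁ = some (P₁, Γ₁) ∧ N r₂ = some (P₂, Γ₂) ∧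
    Active r₁ Γ₁ P₁ p A ∧ Active r₂ Γ₂ P₂ q B ∧ Complementary r₁ r₂ A B

/-- No two sends can interact with the same receive, and no two receives can interact with the same
send. -/
def Net.RaceFree (N : Net S) : Prop :=
  (∀ r₁ p r₁' p' r₂ q, N.CanInteract r₁ p r₂ q → N.CanInteract r₁' p' r₂ q →
    r₁ = r₁' ∧ p = p') ∧
  (∀ r₁ p r₂ q r₂' q', N.CanInteract r₁ p r₂ q → N.CanInteract r₁ p r₂' q' →
    r₂ = r₂' ∧ q = q')

end

end DynChor

/-!
Races are excluded by properties of the single roles.  A process that can terminate has no active send or receive, so two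
sends or receives that are active together in a role lie on the two sides of a parallel composition.
It therefore suffices that, in every process that a role can reach, parallel components never share an
*endpoint*, that is, a direction, an operation and a partner (`Proc.Separated`).

Projections have this property (`separated_projRole`): user operations are told apart by connectedness
for parallel, auxiliary operations by the distinct indexes, and the auxiliary messages of one
construct by their partners.  Updates are the only transitions that put new endpoints into a role.
All of these carry the index of the updated scope, and so are counted as endpoints of the scope from
the start, or one of the fresh indexes of the update.

Since a role receives the code of an update some time after its indexes were chosen, the invariant of
computations (`Net.Separated`) also says that an index of code on its way to a role (`Proc.pending`)
does not occur in that role, and is on its way to it in one place only.  Every transition preserves the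
invariant: `RoleStep.extends` bounds what a role gains by a transition, `Net.Separated.netStep` lifts
this to networks, and `Net.Separated.raceFree` concludes.
-/

namespace DynChor

universe u

variable {S : Sig.{u}}

/-! ### Endpoints, pending indexes and separated processes -/

/-- One end of a communication, seen from the role that performs it: a send or a receive, with its
operation and its partner.  Values and higher-order messages are not distinguished. -/
inductive Endpoint (S : Sig.{u}) : Type u
  | send (o : Op S) (r : S.Role)
  | recv (o : Op S) (r : S.Role)

/-- The operation of an endpoint. -/
def Endpoint.op : Endpoint S → Op S
  | send o _ => o
  | recv o _ => o

namespace Proc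

/-- The endpoints that a process may use.  A scope with index `n` also reserves every endpoint whose
operation has index `n`: these are the ones that an update of the scope uses besides those with fresh
indexes.  The code carried by a higher-order send is not counted, as another role runs it. -/
def endpoints : Proc S → Set (Endpoint S)
  | recv o _ r => {.recv o r}
  | send o _ r => {.send o r}
  | sendProc o _ r => {.send o r}
  | sendNo o r => {.send o r}
  | seq P Q => endpoints P ∪ endpoints Q
  | par P Q => endpoints P ∪ endpoints Q
  | assign _ _ => ∅
  | .while _ P => endpoints P
  | ite _ P Q => endpoints P ∪ endpoints Q
  | scopeLead n _ P _ => {k | n ∈ k.op.indexes} ∪ endpoints P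
  | scopeFollow n _ P => {k | n ∈ k.op.indexes} ∪ endpoints P
  | one => ∅
  | zero => ∅

/-- The pairs `(s, m)` such that code with the index `m` waits to be sent to the role `s`.  The index
of the scope that is updated does not count: it is the only one that the role `s` knows already. -/
def pending : Proc S → Set (S.Role × ℕ)
  | sendProc o X r => {p | p.1 = r ∧ p.2 ∈ X.indexes \ o.indexes}
  | seq P Q => pending P ∪ pending Q
  | par P Q => pending P ∪ pending Q
  | .while _ P => pending P
  | ite _ P Q => pending P ∪ pending Q
  | scopeLead _ _ P _ => pending P
  | scopeFollow _ _ P => pending P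
  | _ => ∅

/-- Parallel components share no endpoint, and no index is pending twice for the same role.  The body
of a loop has nothing pending, since unfolding the loop duplicates it.  The code carried by a
higher-order send is itself separated, has nothing pending, and uses no user operation. -/
def Separated : Proc S → Prop
  | sendProc _ X _ => Separated X ∧ X.pending = ∅ ∧ ∀ k ∈ X.endpoints, k.op.indexes.Nonempty
  | seq P Q => Separated P ∧ Separated Q ∧ Disjoint P.pending Q.pending
  | par P Q => Separated P ∧ Separated Q ∧ Disjoint P.pending Q.pending ∧
      Disjoint P.endpoints Q.endpoints
  | .while _ P => Separated P ∧ P.pending = ∅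
  | ite _ P Q => Separated P ∧ Separated Q
  | scopeLead _ _ P _ => Separated P
  | scopeFollow _ _ P => Separated P
  | _ => True

/-- Code that may be sent to a role for an update. -/
def IsUpdateCode (X : Proc S) : Prop :=
  X.Separated ∧ X.pending = ∅ ∧ ∀ k ∈ X.endpoints, k.op.indexes.Nonempty

theorem indexes_subset_of_mem_endpoints {P : Proc S} {k : Endpoint S} (h : k ∈ P.endpoints) :
    k.op.indexes ⊆ P.indexes := by
  induction P with
  | scopeLead n r P R ih | scopeFollow n r P ih =>
    rcases h with h | h
    · intro m hm
      left
      -- an operation has at most one index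
      rcases k with ⟨o, _⟩ | ⟨o, _⟩ <;> cases o <;>
        simp_all [Endpoint.op, Op.indexes]
    · exact (ih h).trans Set.subset_union_right
  | _ =>
    intro m hm
    simp only [endpoints, Set.mem_singleton_iff, Set.mem_union, Set.mem_empty_iff_false] at h <;>
      simp only [indexes] <;> grind [Endpoint.op]

theorem mem_indexes_of_mem_pending {P : Proc S} {p : S.Role × ℕ} (h : p ∈ P.pending) :
    p.2 ∈ P.indexes := by
  induction P <;> simp only [pending, indexes, Set.mem_union, Set.mem_empty_iff_false,
    Set.mem_ofPred_eq, Set.mem_sdiff] at * <;> tauto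

/-! ### Products -/

theorem mem_endpoints_parList {L : List (Proc S)} {k : Endpoint S} :
    k ∈ (parList L).endpoints ↔ ∃ P ∈ L, k ∈ P.endpoints := by
  induction L using parList.induct <;> simp_all [parList, endpoints]

theorem mem_pending_parList {L : List (Proc S)} {p : S.Role × ℕ} :
    p ∈ (parList L).pending ↔ ∃ P ∈ L, p ∈ P.pending := by
  induction L using parList.induct <;> simp_all [parList, pending]

theorem mem_indexes_parList {L : List (Proc S)} {m : ℕ} :
    m ∈ (parList L).indexes ↔ ∃ P ∈ L, m ∈ P.indexes := by
  induction L using parList.induct <;> simp_all [parList, indexes]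

theorem separated_parList {L : List (Proc S)} (h : ∀ P ∈ L, P.Separated)
    (hL : L.Pairwise fun P Q => Disjoint P.pending Q.pending ∧ Disjoint P.endpoints Q.endpoints) :
    (parList L).Separated := by
  induction L using parList.induct with
  | case1 => trivial
  | case2 P => exact h P (by simp)
  | case3 P Q L ih =>
    obtain ⟨h1, h2⟩ := List.pairwise_cons.1 hL
    refine ⟨h P (by simp), ih (fun R hR => h R (by simp_all)) h2, ?_, ?_⟩ <;>
      rw [Set.disjoint_left] <;> intro x hx hx'
    · obtain ⟨R, hR, hxR⟩ := mem_pending_parList.1 hx'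
      exact Set.disjoint_left.1 (h1 R hR).1 hx hxR
    · obtain ⟨R, hR, hxR⟩ := mem_endpoints_parList.1 hx'
      exact Set.disjoint_left.1 (h1 R hR).2 hx hxR

theorem mem_endpoints_prod {R : Finset S.Role} {f : S.Role → Proc S} {k : Endpoint S} :
    k ∈ (prod R f).endpoints ↔ ∃ s ∈ R, k ∈ (f s).endpoints := by
  simp [prod, mem_endpoints_parList]

theorem mem_pending_prod {R : Finset S.Role} {f : S.Role → Proc S} {p : S.Role × ℕ} :
    p ∈ (prod R f).pending ↔ ∃ s ∈ R, p ∈ (f s).pending := by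
  simp [prod, mem_pending_parList]

theorem mem_indexes_prod {R : Finset S.Role} {f : S.Role → Proc S} {m : ℕ} :
    m ∈ (prod R f).indexes ↔ ∃ s ∈ R, m ∈ (f s).indexes := by
  simp [prod, mem_indexes_parList]

theorem separated_prod {R : Finset S.Role} {f : S.Role → Proc S} (h : ∀ s ∈ R, (f s).Separated)
    (hp : ∀ s t, s ≠ t → Disjoint (f s).pending (f t).pending)
    (he : ∀ s t, s ≠ t → Disjoint (f s).endpoints (f t).endpoints) : (prod R f).Separated := by
  refine separated_parList (by simpa using h) (List.pairwise_map.2 ?_)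
  exact (Finset.nodup_toList R).imp fun hst => ⟨hp _ _ hst, he _ _ hst⟩

theorem pending_prod_send (R : Finset S.Role) (o : Op S) (e : S.Expr) :
    (prod R fun s => .send o e s).pending = ∅ := by
  ext p; simp [mem_pending_prod, pending]

theorem pending_prod_recv (R : Finset S.Role) (o : Op S) (x : PVar S) :
    (prod R fun s => .recv o x s).pending = ∅ := by
  ext p; simp [mem_pending_prod, pending]

theorem pending_prod_sendNo (R : Finset S.Role) (o : Op S) :
    (prod R fun s => .sendNo o s).pending = ∅ := by
  ext p; simp [mem_pending_prod, pending]

theorem separated_prod_send (R : Finset S.Role) (o : Op S) (e : S.Expr) :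
    (prod R fun s => .send o e s).Separated :=
  separated_prod (fun _ _ => trivial) (by simp [pending]) (by simp [endpoints])

theorem separated_prod_recv (R : Finset S.Role) (o : Op S) (x : PVar S) :
    (prod R fun s => .recv o x s).Separated :=
  separated_prod (fun _ _ => trivial) (by simp [pending]) (by simp [endpoints])

theorem separated_prod_sendNo (R : Finset S.Role) (o : Op S) :
    (prod R fun s => .sendNo o s).Separated :=
  separated_prod (fun _ _ => trivial) (by simp [pending]) (by simp [endpoints])

end Proc

/-! ### Projections are separated -/

namespace Dioc

variable {O O' : Type u} {A A' : Type}

/-- Connectedness for parallel alone: parallel components share no operation signature. -/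
def ParSeparated : Dioc S O A → Prop
  | seq I J => ParSeparated I ∧ ParSeparated J
  | par I J => ParSeparated I ∧ ParSeparated J ∧ Disjoint I.operations J.operations
  | ite _ _ _ I J => ParSeparated I ∧ ParSeparated J
  | .while _ _ _ I => ParSeparated I
  | scope _ _ I => ParSeparated I
  | _ => True

theorem Connected.parSeparated {I : Dioc S O A} (h : I.Connected) : I.ParSeparated := by
  induction I <;> simp only [Connected, ParSeparated, Set.disjoint_iff_inter_eq_empty] at * <;> tauto

theorem operations_map (f : O → O') (g : A → A') (I : Dioc S O A) :
    (I.map f g).operations = Prod.map f id '' I.operations := by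
  induction I <;> simp_all [map, operations, Set.image_union]

theorem parSeparated_map_iff {f : O → O'} (hf : f.Injective) (g : A → A') (I : Dioc S O A) :
    (I.map f g).ParSeparated ↔ I.ParSeparated := by
  induction I <;> simp_all [map, ParSeparated, operations_map,
    Set.disjoint_image_iff (hf.prodMap Function.injective_id)]

theorem annotations_map (f : O → O') (I : Dioc S O A) :
    (I.map f id).annotations = I.annotations := by
  induction I <;> simp_all [map, annotations]

end Dioc

open Proc in
theorem pending_projRole (D : Dioc S (Op S) ℕ) (s : S.Role) : (projRole D s).pending = ∅ := by
  induction D <;> simp only [projRole] <;> (try split_ifs) <;>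
    simp_all [pending, pending_prod_send, pending_prod_recv]

open Proc in
theorem indexes_projRole_subset {D : Dioc S (Op S) ℕ} {s : S.Role} {m : ℕ}
    (h : m ∈ (projRole D s).indexes) :
    m ∈ D.annotations ∨ ∃ p ∈ D.operations, m ∈ p.1.indexes := by
  induction D <;> simp only [projRole] at h <;> (try split_ifs at h) <;>
    simp [indexes, mem_indexes_prod, Op.indexes, PVar.indexes, Guard.indexes, Dioc.annotations,
      Dioc.operations] at * <;> grind

/-- The signature of the interactions that have the given endpoint at the role `s`. -/
def Endpoint.signature (s : S.Role) : Endpoint S → Op S × S.Role × S.Role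
  | send o r => (o, s, r)
  | recv o r => (o, r, s)

open Proc in
theorem endpoints_projRole_subset {D : Dioc S (Op S) ℕ} {s : S.Role} {k : Endpoint S}
    (h : k ∈ (projRole D s).endpoints) :
    (∃ m ∈ D.annotations, m ∈ k.op.indexes) ∨ k.signature s ∈ D.operations := by
  induction D <;> simp only [projRole] at h <;> (try split_ifs at h) <;>
    simp [endpoints, mem_endpoints_prod, Dioc.annotations,
      Dioc.operations] at * <;> grind [Endpoint.op, Endpoint.signature, Op.indexes]

theorem Op.indexes_subsingleton (o : Op S) : o.indexes.Subsingleton := by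
  cases o <;> simp [Op.indexes]

/-- Separation of parallel components of a projection: endpoints of auxiliary operations differ since
all annotations do, the others since the components share no operation signature. -/
theorem separated_projRole {D : Dioc S (Op S) ℕ} (hD : D.ParSeparated)
    (hnd : D.annotations.Nodup)
    (hop : ∀ p ∈ D.operations, ∀ m ∈ p.1.indexes, m ∉ D.annotations) (s : S.Role) :
    (projRole D s).Separated := by
  induction D with
  | par I J ihI ihJ =>
    obtain ⟨h1, h2, h3⟩ := hD
    simp only [Dioc.annotations, List.nodup_append', Dioc.operations, Set.mem_union,
      List.mem_append] at hnd hop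
    refine ⟨ihI h1 hnd.1 fun p hp m hm h => hop p (.inl hp) m hm (.inl h),
      ihJ h2 hnd.2.1 fun p hp m hm h => hop p (.inr hp) m hm (.inr h),
      by simp [pending_projRole], Set.disjoint_left.2 fun k hI hJ => ?_⟩
    have hk : (k.signature s).1 = k.op := by cases k <;> rfl
    rcases endpoints_projRole_subset hI with ⟨m, hm, hmk⟩ | hI <;>
      rcases endpoints_projRole_subset hJ with ⟨m', hm', hmk'⟩ | hJ
    · exact hnd.2.2 hm (k.op.indexes_subsingleton hmk hmk' ▸ hm')
    · exact hop _ (.inr hJ) m (hk ▸ hmk) (.inl hm)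
    · exact hop _ (.inl hI) m' (hk ▸ hmk') (.inr hm')
    · exact Set.disjoint_left.1 h3 hI hJ
  | seq I J ihI ihJ =>
    simp only [Dioc.annotations, List.nodup_append', List.mem_append] at hnd hop
    exact ⟨ihI hD.1 hnd.1 fun p hp m hm h => hop p (.inl hp) m hm (.inl h),
      ihJ hD.2 hnd.2.1 fun p hp m hm h => hop p (.inr hp) m hm (.inr h),
      by simp [pending_projRole]⟩
  | ite n b r I J ihI ihJ =>
    simp only [Dioc.annotations, List.nodup_cons, List.nodup_append', List.mem_cons,
      List.mem_append] at hnd hop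
    have hI := ihI hD.1 hnd.2.1 fun p hp m hm h => hop p (.inl hp) m hm (.inr (.inl h))
    have hJ := ihJ hD.2 hnd.2.2.1 fun p hp m hm h => hop p (.inr hp) m hm (.inr (.inr h))
    simp only [projRole]
    split_ifs <;> simp [Proc.Separated, Proc.pending, pending_projRole, Proc.separated_prod_send,
      Proc.pending_prod_send, hI, hJ]
  | scope n r I ihI =>
    simp only [Dioc.annotations, List.nodup_cons, List.mem_cons] at hnd hop
    have hI := ihI hD hnd.2 fun p hp m hm h => hop p hp m hm (.inr h)
    simp only [projRole]
    split_ifs <;> simp [Proc.Separated, hI]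
  | comm | assign => simp only [projRole]; split_ifs <;> trivial
  | one | zero => trivial
  | _ =>
    -- the remaining case is that of loops
    rename_i n b r I ihI
    simp only [Dioc.annotations, List.nodup_cons, List.mem_cons] at hnd hop
    have hI := ihI hD hnd.2 fun p hp m hm h => hop p hp m hm (.inr h)
    simp only [projRole]
    split_ifs <;> simp [Proc.Separated, Proc.pending, pending_projRole, Proc.separated_prod_send,
      Proc.pending_prod_send, Proc.separated_prod_recv, Proc.pending_prod_recv, hI]

theorem indexes_projUpdate_subset {n m : ℕ} {J : AnnChoreo S} {s : S.Role}
    (h : m ∈ (projUpdate n J s).indexes) : m = n ∨ m ∈ J.annotations := by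
  rcases indexes_projRole_subset h with h | ⟨p, hp, hm⟩
  · rw [Dioc.annotations_map] at h
    exact .inr h
  · rw [Dioc.operations_map] at hp
    obtain ⟨q, -, rfl⟩ := hp
    exact .inl hm

theorem isUpdateCode_projUpdate {n : ℕ} {J : AnnChoreo S} (hJ : J.erase.Connected)
    (hwell : J.WellAnnotated) (hn : n ∉ J.annotations) (s : S.Role) :
    (projUpdate n J s).IsUpdateCode := by
  have hinj : Function.Injective (Op.ext n : UserOp S → Op S) := fun _ _ h => by cases h; rfl
  refine ⟨separated_projRole ?_ ?_ ?_ s, pending_projRole _ _, fun k hk => ?_⟩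
  · rw [Dioc.parSeparated_map_iff hinj]
    exact (Dioc.parSeparated_map_iff Function.injective_id _ J).1 hJ.parSeparated
  · rwa [Dioc.annotations_map]
  · rw [Dioc.operations_map, Dioc.annotations_map]
    rintro _ ⟨p, -, rfl⟩ m hm
    rwa [show m = n from hm]
  · rcases endpoints_projRole_subset hk with ⟨m, -, hm⟩ | h
    · exact ⟨m, hm⟩
    · rw [Dioc.operations_map] at h
      obtain ⟨p, -, hp⟩ := h
      have hk : (k.signature s).1 = k.op := by cases k <;> rfl
      rw [← hk, ← hp]
      exact ⟨n, rfl⟩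

/-! ### Transitions of a role -/

/-- The indexes that a transition with the given label may bring into the role that performs it. -/
def Label.newIndexes : Label S → Set ℕ
  | .update J => {m | m ∈ J.annotations}
  | .recvHO _ o (some X) _ => X.indexes \ o.indexes
  | _ => ∅

/-- The indexes that become pending by a transition of the role `r` with the given label. -/
def Label.newPending (r : S.Role) : Label S → Set (S.Role × ℕ)
  | .update J => {p | p.1 ≠ r ∧ p.2 ∈ J.annotations}
  | _ => ∅

/-- What has to be known of the code that a transition brings into a role. -/
def Label.Admissible : Label S → Prop
  | .update J => J.erase.Connected
  | .recvHO _ _ (some X) _ => X.IsUpdateCode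
  | _ => True

theorem Label.mem_newIndexes_of_mem_newPending {r : S.Role} {δ : Label S} {p : S.Role × ℕ}
    (h : p ∈ δ.newPending r) : p.2 ∈ δ.newIndexes := by
  cases δ <;> simp_all [newPending, newIndexes]

/-- `P'` is separated, and all it has beyond `P` is marked by indexes in `A` or pending in `B`. -/
structure Extends (P P' : Proc S) (A : Set ℕ) (B : Set (S.Role × ℕ)) : Prop where
  separated : P'.Separated
  indexes : P'.indexes ⊆ P.indexes ∪ A
  endpoints : ∀ k ∈ P'.endpoints, k ∈ P.endpoints ∨ ∃ m ∈ A, m ∈ k.op.indexes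
  pending : P'.pending ⊆ P.pending ∪ B

theorem Extends.disjoint_pending {P P' Q : Proc S} {A : Set ℕ} {B : Set (S.Role × ℕ)}
    (h : Extends P P' A B) (hPQ : Disjoint P.pending Q.pending) (hB : ∀ p ∈ B, p.2 ∈ A)
    (hA : Disjoint A Q.indexes) : Disjoint P'.pending Q.pending := by
  refine Set.disjoint_left.2 fun p hp hq => ?_
  rcases h.pending hp with hp | hp
  · exact Set.disjoint_left.1 hPQ hp hq
  · exact Set.disjoint_left.1 hA (hB p hp) (Proc.mem_indexes_of_mem_pending hq)

theorem Extends.disjoint_endpoints {P P' Q : Proc S} {A : Set ℕ} {B : Set (S.Role × ℕ)}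
    (h : Extends P P' A B) (hPQ : Disjoint P.endpoints Q.endpoints)
    (hA : Disjoint A Q.indexes) : Disjoint P'.endpoints Q.endpoints := by
  refine Set.disjoint_left.2 fun k hk hq => ?_
  rcases h.endpoints k hk with hk | ⟨m, hm, hmk⟩
  · exact Set.disjoint_left.1 hPQ hk hq
  · exact Set.disjoint_left.1 hA hm (Proc.indexes_subset_of_mem_endpoints hq hmk)

theorem Extends.seqLeft {P P' Q : Proc S} {A : Set ℕ} {B : Set (S.Role × ℕ)}
    (h : Extends P P' A B) (hPQ : (Proc.seq P Q).Separated) (hB : ∀ p ∈ B, p.2 ∈ A)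
    (hA : Disjoint A (Proc.seq P Q).indexes) : Extends (.seq P Q) (.seq P' Q) A B where
  separated := ⟨h.separated, hPQ.2.1, h.disjoint_pending hPQ.2.2 hB
    (hA.mono_right Set.subset_union_right)⟩
  indexes := by have := h.indexes; simp only [Proc.indexes]; grind
  endpoints := by have := h.endpoints; simp only [Proc.endpoints]; grind
  pending := by have := h.pending; simp only [Proc.pending]; grind

theorem Extends.parLeft {P P' Q : Proc S} {A : Set ℕ} {B : Set (S.Role × ℕ)}
    (h : Extends P P' A B) (hPQ : (Proc.par P Q).Separated) (hB : ∀ p ∈ B, p.2 ∈ A)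
    (hA : Disjoint A (Proc.par P Q).indexes) : Extends (.par P Q) (.par P' Q) A B where
  separated := ⟨h.separated, hPQ.2.1, h.disjoint_pending hPQ.2.2.1 hB
    (hA.mono_right Set.subset_union_right), h.disjoint_endpoints hPQ.2.2.2
    (hA.mono_right Set.subset_union_right)⟩
  indexes := by have := h.indexes; simp only [Proc.indexes]; grind
  endpoints := by have := h.endpoints; simp only [Proc.endpoints]; grind
  pending := by have := h.pending; simp only [Proc.pending]; grind

theorem Extends.parRight {P Q Q' : Proc S} {A : Set ℕ} {B : Set (S.Role × ℕ)}
    (h : Extends Q Q' A B) (hPQ : (Proc.par P Q).Separated) (hB : ∀ p ∈ B, p.2 ∈ A)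
    (hA : Disjoint A (Proc.par P Q).indexes) : Extends (.par P Q) (.par P Q') A B where
  separated := ⟨hPQ.1, h.separated, (h.disjoint_pending hPQ.2.2.1.symm hB
    (hA.mono_right Set.subset_union_left)).symm, (h.disjoint_endpoints hPQ.2.2.2.symm
    (hA.mono_right Set.subset_union_left)).symm⟩
  indexes := by have := h.indexes; simp only [Proc.indexes]; grind
  endpoints := by have := h.endpoints; simp only [Proc.endpoints]; grind
  pending := by have := h.pending; simp only [Proc.pending]; grind

open Proc in
/-- The update of a scope: an endpoint of the new code has either the index of the scope, and was
reserved by it, or one of the indexes chosen for the update. -/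
theorem extends_leadUp {n : ℕ} {r : S.Role} {P : Proc S} {R : Finset S.Role} {J : AnnChoreo S}
    (hJ : J.erase.Connected) (hwell : J.WellAnnotated) (hn : n ∉ J.annotations) :
    Extends (.scopeLead n r P R)
      (.seq (prod (R \ {r}) fun s => .sendProc (.aux n) (projUpdate n J s) s)
        (.seq (projUpdate n J r) (prod (R \ {r}) fun s => .recv (.aux n) .dummy s)))
      {m | m ∈ J.annotations} {p | p.1 ≠ r ∧ p.2 ∈ J.annotations} where
  separated := by
    have hcode := isUpdateCode_projUpdate hJ hwell hn
    refine ⟨separated_prod (fun s _ => hcode s) ?_ (by simp [Proc.endpoints]),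
      ⟨(hcode r).1, separated_prod_recv _ _ _, ?_⟩, ?_⟩
    · intro s t hst
      refine Set.disjoint_left.2 fun p hs ht => hst ?_
      exact hs.1.symm.trans ht.1
    · simp [pending_prod_recv]
    · simp [Proc.pending, pending_prod_recv, (hcode r).2.1]
  indexes := by
    intro m hm
    have := @indexes_projUpdate_subset _ n m J
    simp [Proc.indexes, mem_indexes_prod, Op.indexes, PVar.indexes] at hm ⊢
    grind
  endpoints := by
    intro k hk
    simp only [Proc.endpoints, Set.mem_union, mem_endpoints_prod, Set.mem_singleton_iff,
      Set.mem_ofPred_eq] at hk ⊢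
    rcases hk with ⟨s, -, rfl⟩ | hk | ⟨s, -, rfl⟩
    · exact .inl (.inl rfl)
    · obtain ⟨m, hm⟩ := (isUpdateCode_projUpdate hJ hwell hn r).2.2 k hk
      rcases indexes_projUpdate_subset (indexes_subset_of_mem_endpoints hk hm) with rfl | h
      · exact .inl (.inl hm)
      · exact .inr ⟨m, h, hm⟩
    · exact .inl (.inl rfl)
  pending := by
    rintro ⟨s, m⟩ hp
    have := @indexes_projUpdate_subset _ n m J s
    simp [Proc.pending, mem_pending_prod, pending_prod_recv, Op.indexes,
      (isUpdateCode_projUpdate hJ hwell hn r).2.1] at hp ⊢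
    grind

/-- What a role gains by a transition.  Fresh indexes keep the new endpoints apart from the parallel
context of the redex, which is why the invariant passes through parallel composition. -/
theorem RoleStep.extends {r : S.Role} {P P' : Proc S} {Γ Γ' : Store S} {δ : Label S}
    (h : RoleStep r P Γ δ P' Γ') (hP : P.Separated) (hδ : δ.Admissible)
    (hA : Disjoint δ.newIndexes P.indexes) :
    Extends P P' δ.newIndexes (δ.newPending r) := by
  have hB : ∀ δ : Label S, ∀ p ∈ δ.newPending r, p.2 ∈ δ.newIndexes :=
    fun _ _ => Label.mem_newIndexes_of_mem_newPending
  induction h with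
  | seq h _ ih =>
    exact (ih hP.1 hδ (hA.mono_right Set.subset_union_left)).seqLeft hP (hB _) hA
  | seqEnd _ _ _ ih =>
    have := ih hP.2.1 hδ (hA.mono_right Set.subset_union_right)
    obtain ⟨h1, h2, h3, h4⟩ := this
    refine ⟨h1, ?_, ?_, ?_⟩
    · simp only [Proc.indexes]; grind
    · simp only [Proc.endpoints]; grind
    · simp only [Proc.pending]; grind
  | parLeft h _ ih =>
    exact (ih hP.1 hδ (hA.mono_right Set.subset_union_left)).parLeft hP (hB _) hA
  | parRight h _ ih =>
    exact (ih hP.2.1 hδ (hA.mono_right Set.subset_union_right)).parRight hP (hB _) hA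
  | parEnd _ _ ih₁ ih₂ =>
    have e₁ := (ih₁ hP.1 hδ (hA.mono_right Set.subset_union_left)).parLeft hP (hB _) hA
    have e₂ := (ih₂ hP.2.1 hδ (hA.mono_right Set.subset_union_right)).parRight e₁.separated (hB _)
      (by simp [Label.newIndexes])
    obtain ⟨-, h2, h3, h4⟩ := e₁
    obtain ⟨g1, g2, g3, g4⟩ := e₂
    exact ⟨g1, by grind, by grind, by grind⟩
  | leadUp hwell _ => exact extends_leadUp hδ hwell fun hn => Set.disjoint_left.1 hA hn (.inl rfl)
  | @up n r' P X Γ =>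
    obtain ⟨h1, h2, h3⟩ := hδ
    refine ⟨⟨h1, trivial, by simp [h2]⟩, ?_, ?_, ?_⟩
    · intro m hm
      simp [Proc.indexes, Label.newIndexes, Op.indexes] at hm ⊢
      tauto
    · rintro k (hk | rfl)
      · obtain ⟨m, hm⟩ := h3 k hk
        by_cases hmn : m = n
        · exact .inl (.inl (hmn ▸ hm))
        · exact .inr ⟨m, ⟨Proc.indexes_subset_of_mem_endpoints hk hm, hmn⟩, hm⟩
      · exact .inl (.inl rfl)
    · simp [Proc.pending, h2]
  | leadNoUp =>
    refine ⟨⟨Proc.separated_prod_sendNo _ _, ⟨hP, Proc.separated_prod_recv _ _ _, ?_⟩, ?_⟩, ?_, ?_, ?_⟩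
    · simp [Proc.pending_prod_recv]
    · simp [Proc.pending_prod_sendNo]
    · intro m hm
      simp [Proc.indexes, Proc.mem_indexes_prod, Op.indexes, PVar.indexes] at hm ⊢
      tauto
    · intro k hk
      simp only [Proc.endpoints, Set.mem_union, Proc.mem_endpoints_prod,
        Set.mem_singleton_iff] at hk ⊢
      rcases hk with ⟨s, -, rfl⟩ | hk | ⟨s, -, rfl⟩
      · exact .inl (.inl rfl)
      · exact .inl (.inr hk)
      · exact .inl (.inl rfl)
    · simp [Proc.pending, Proc.pending_prod_recv, Proc.pending_prod_sendNo]
  | noUp =>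
    refine ⟨⟨hP, trivial, by simp [Proc.pending]⟩, ?_, ?_, ?_⟩
    · intro m hm
      simp [Proc.indexes, Op.indexes] at hm ⊢
      tauto
    · rintro k (hk | rfl)
      · exact .inl (.inr hk)
      · exact .inl (.inl rfl)
    · simp [Proc.pending]
  | _ =>
    constructor
    · simp_all [Proc.Separated, Proc.pending]
    · intro m hm
      simp [Proc.indexes] at hm ⊢ <;> tauto
    · intro k hk
      simp [Proc.endpoints] at hk ⊢ <;> tauto
    · intro p hp
      simp [Proc.pending] at hp ⊢ <;> tauto

/-- Code that is sent was pending, and is not pending any more. -/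
theorem RoleStep.sendHO_code {r r₁ r₂ : S.Role} {P P' X : Proc S} {Γ Γ' : Store S} {o : Op S}
    (h : RoleStep r P Γ (.sendHO r₁ o (some X) r₂) P' Γ') (hP : P.Separated) :
    X.IsUpdateCode ∧ ∀ m ∈ X.indexes \ o.indexes, (r₂, m) ∈ P.pending ∧ (r₂, m) ∉ P'.pending := by
  generalize hδ : Label.sendHO r₁ o (some X) r₂ = δ at h
  induction h with
  | sendProc o X r' Γ =>
    cases hδ
    exact ⟨hP, fun m hm => ⟨⟨rfl, hm⟩, fun h => h⟩⟩
  | seq _ _ ih =>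
    have h := ih hP.1 hδ
    refine ⟨h.1, fun m hm => ⟨.inl (h.2 m hm).1, ?_⟩⟩
    rintro (h' | h')
    · exact (h.2 m hm).2 h'
    · exact Set.disjoint_left.1 hP.2.2 (h.2 m hm).1 h'
  | seqEnd _ _ _ ih =>
    have h := ih hP.2.1 hδ
    exact ⟨h.1, fun m hm => ⟨.inr (h.2 m hm).1, (h.2 m hm).2⟩⟩
  | parLeft _ _ ih =>
    have h := ih hP.1 hδ
    refine ⟨h.1, fun m hm => ⟨.inl (h.2 m hm).1, ?_⟩⟩
    rintro (h' | h')
    · exact (h.2 m hm).2 h'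
    · exact Set.disjoint_left.1 hP.2.2.1 (h.2 m hm).1 h'
  | parRight _ _ ih =>
    have h := ih hP.2.1 hδ
    refine ⟨h.1, fun m hm => ⟨.inr (h.2 m hm).1, ?_⟩⟩
    rintro (h' | h')
    · exact Set.disjoint_left.1 hP.2.2.1 h' (h.2 m hm).1
    · exact (h.2 m hm).2 h'
  | _ => cases hδ

theorem RoleStep.recvHO_role {r r₁ r₂ : S.Role} {P P' : Proc S} {X : Option (Proc S)}
    {Γ Γ' : Store S} {o : Op S} (h : RoleStep r P Γ (.recvHO r₂ o X r₁) P' Γ') : r₂ = r := by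
  generalize hδ : Label.recvHO r₂ o X r₁ = δ at h
  induction h <;> first | cases hδ <;> done | (cases hδ; rfl) | (rename_i ih; exact ih hδ)

/-! ### Transitions of a network -/

/-- The network in which the role `r` is replaced by `x`. -/
def Net.update (N : Net S) (r : S.Role) (x : Proc S × Store S) : Net S :=
  fun s => if s = r then some x else N s

/-- Transitions of networks, described by the roles that move. -/
inductive NetStep : Net S → Label S → Net S → Prop
  | role {N : Net S} {r : S.Role} {P P' : Proc S} {Γ Γ' : Store S} {δ : Label S} :
      N r = some (P, Γ) → RoleStep r P Γ δ P' Γ' → δ ≠ .tick →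
        (∀ J, δ = .update J → J.erase.Connected ∧ N.FreshFor J) →
        NetStep N δ (N.update r (P', Γ'))
  | tick {N N' : Net S} :
      (∀ r, (N r = none ∧ N' r = none) ∨ ∃ P Γ P' Γ', N r = some (P, Γ) ∧ N' r = some (P', Γ') ∧
        RoleStep r P Γ .tick P' Γ') → NetStep N .tick N'
  | changeUpdates (U : Set (Choreo S)) (N : Net S) : NetStep N (.changeUpdates U) N
  | comm {N : Net S} {s t r₁ r₂ : S.Role} {P P' Q Q' : Proc S} {Γ Γ' Δ Δ' : Store S} {o : Op S}
      {v : S.Val} {x : PVar S} : s ≠ t → N s = some (P, Γ) → N t = some (Q, Δ) →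
        RoleStep s P Γ (.send r₁ o v r₂) P' Γ' → RoleStep t Q Δ (.recv r₂ o x v r₁) Q' Δ' →
        NetStep N (.comm o r₁ v r₂ x)
          ((N.update s (P', Γ')).update t (Q', Δ'))
  | commHO {N : Net S} {s t r₁ r₂ : S.Role} {P P' Q Q' : Proc S} {Γ Γ' Δ Δ' : Store S} {o : Op S}
      {X : Option (Proc S)} : s ≠ t → N s = some (P, Γ) → N t = some (Q, Δ) →
        RoleStep s P Γ (.sendHO r₁ o X r₂) P' Γ' → RoleStep t Q Δ (.recvHO r₂ o X r₁) Q' Δ' →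
        NetStep N (.commHO o r₁ X r₂)
          ((N.update s (P', Γ')).update t (Q', Δ'))

namespace Net

theorem par_apply_left {N M : Net S} {r : S.Role} {x : Proc S × Store S} (h : N r = some x) :
    N.par M r = some x := by
  simp [par, h]

theorem par_apply_right {N M : Net S} {r : S.Role} {x : Proc S × Store S} (h : M r = some x)
    (hd : N.Disjoint M) : N.par M r = some x := by
  have := hd r
  simp_all [par]

theorem update_self (N : Net S) (r : S.Role) (x : Proc S × Store S) : N.update r x r = some x := by
  simp [update]

theorem update_of_ne {N : Net S} {r s : S.Role} {x : Proc S × Store S} (h : s ≠ r) :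
    N.update r x s = N s := by
  simp [update, h]

theorem update_par (N M : Net S) (r : S.Role) (x : Proc S × Store S) :
    (N.update r x).par M = (N.par M).update r x := by
  funext s
  by_cases h : s = r <;> simp [par, update, h]

theorem update_par_update {N M : Net S} {s t : S.Role} (x y : Proc S × Store S) (ht : N t = none)
    (hst : s ≠ t) : (N.update s x).par (M.update t y) = ((N.par M).update s x).update t y := by
  funext r
  by_cases h : r = t
  · subst h; simp [par, update, hst.symm, ht]
  · by_cases h' : r = s
    · subst h'; simp [par, update, h]
    · simp [par, update, h, h']

theorem update_single (r : S.Role) (P P' : Proc S) (Γ Γ' : Store S) :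
    (single r P Γ).update r (P', Γ') = single r P' Γ' := by
  funext s
  by_cases h : s = r <;> simp [single, update, h]

theorem FreshFor.par {N M : Net S} {J : AnnChoreo S} (hN : N.FreshFor J) (hM : M.FreshFor J) :
    (N.par M).FreshFor J := by
  intro m hm r P Γ h
  rcases Option.or_eq_some_iff.1 h with h | h
  · exact hN m hm r P Γ h
  · exact hM m hm r P Γ h.2

end Net

theorem NetStep.par {N N' M : Net S} {η : Label S} (h : NetStep N η N') (hη : η ≠ .tick)
    (hM : ∀ J, η = .update J → M.FreshFor J) :
    NetStep (N.par M) η (N'.par M) := by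
  cases h with
  | role h1 h2 h3 h4 =>
    rw [Net.update_par]
    exact .role (Net.par_apply_left h1) h2 h3 fun J hJ => ⟨(h4 J hJ).1, (h4 J hJ).2.par (hM J hJ)⟩
  | tick => exact absurd rfl hη
  | changeUpdates U => exact .changeUpdates U _
  | comm hst h1 h2 h3 h4 =>
    rw [Net.update_par, Net.update_par]
    exact .comm hst (Net.par_apply_left h1) (Net.par_apply_left h2) h3 h4
  | commHO hst h1 h2 h3 h4 =>
    rw [Net.update_par, Net.update_par]
    exact .commHO hst (Net.par_apply_left h1) (Net.par_apply_left h2) h3 h4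

theorem Step.netStep {U U' : Set (Choreo S)} {N N' : Net S} {η : Label S}
    (h : Step U N η U' N') : NetStep N η N' := by
  induction h with
  | @lift r P P' Γ Γ' δ h hδ =>
    by_cases ht : δ = .tick
    · subst ht
      refine .tick fun s => ?_
      by_cases hs : s = r
      · subst hs
        exact .inr ⟨P, Γ, P', Γ', by simp [Net.single], by simp [Net.single], h⟩
      · exact .inl (by simp [Net.single, hs])
    · rw [← Net.update_single r P P' Γ Γ']
      exact .role (by simp [Net.single]) h ht fun J hJ => absurd hJ (hδ J)
  | @liftUp r P P' Γ Γ' J h hJ _ hfresh =>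
    rw [← Net.update_single r P P' Γ Γ']
    refine .role (by simp [Net.single]) h (by simp) fun J' hJ' => ?_
    cases hJ'
    exact ⟨hJ, hfresh⟩
  | changeUpdates => exact .changeUpdates _ _
  | synch _ _ hd ih₁ ih₂ =>
    obtain @⟨_, s, _, _, _, _, _, a1, a2, -, -⟩ := ih₁
    obtain @⟨_, t, _, _, _, _, _, b1, b2, -, -⟩ := ih₂
    have hNt := (hd t).resolve_right (by simp [b1])
    have hst : s ≠ t := by rintro rfl; simp [a1] at hNt
    rw [Net.update_par_update _ _ hNt hst]
    exact .comm hst (Net.par_apply_left a1) (Net.par_apply_right b1 hd) a2 b2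
  | synchUp _ _ hd ih₁ ih₂ =>
    obtain @⟨_, s, _, _, _, _, _, a1, a2, -, -⟩ := ih₁
    obtain @⟨_, t, _, _, _, _, _, b1, b2, -, -⟩ := ih₂
    have hNt := (hd t).resolve_right (by simp [b1])
    have hst : s ≠ t := by rintro rfl; simp [a1] at hNt
    rw [Net.update_par_update _ _ hNt hst]
    exact .commHO hst (Net.par_apply_left a1) (Net.par_apply_right b1 hd) a2 b2
  | extParallel _ hη _ hM ih => exact ih.par hη hM
  | @extParEnd N N' M M' _ _ hd ih₁ ih₂ =>
    cases ih₁ with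
    | role _ _ h => exact absurd rfl h
    | tick h₁ =>
    cases ih₂ with
    | role _ _ h => exact absurd rfl h
    | tick h₂ =>
    refine .tick fun r => ?_
    rcases h₁ r with ⟨e, e'⟩ | ⟨P, Γ, P', Γ', e, e', hs⟩
    · have := h₂ r
      simpa [Net.par, e, e'] using this
    · exact .inr ⟨P, Γ, P', Γ', by simp [Net.par, e], by simp [Net.par, e'], hs⟩

/-! ### The invariant -/

/-- The invariant of computations: every role is separated, and an index that is pending for a role
does not occur in this role and is pending for it in one place only. -/
structure Net.Separated (N : Net S) : Prop where
  separated : ∀ r P Γ, N r = some (P, Γ) → P.Separated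
  pending_fresh : ∀ r P Γ s Q Δ m, N r = some (P, Γ) → N s = some (Q, Δ) → (s, m) ∈ P.pending →
    m ∉ Q.indexes
  pending_disjoint : ∀ r P Γ s Q Δ, r ≠ s → N r = some (P, Γ) → N s = some (Q, Δ) →
    _root_.Disjoint P.pending Q.pending

theorem Net.Separated.mono {N N' : Net S} (hN : N.Separated)
    (h : ∀ r P' Γ', N' r = some (P', Γ') → ∃ P Γ, N r = some (P, Γ) ∧ Extends P P' ∅ ∅) :
    N'.Separated where
  separated r P' Γ' h' := by
    obtain ⟨P, Γ, -, e⟩ := h r P' Γ' h'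
    exact e.separated
  pending_fresh r P' Γ' s Q' Δ' m hr hs hm hm' := by
    obtain ⟨P, Γ, hP, e⟩ := h r P' Γ' hr
    obtain ⟨Q, Δ, hQ, f⟩ := h s Q' Δ' hs
    exact hN.pending_fresh r P Γ s Q Δ m hP hQ (by simpa using e.pending hm)
      (by simpa using f.indexes hm')
  pending_disjoint r P' Γ' s Q' Δ' hrs hr hs := by
    obtain ⟨P, Γ, hP, e⟩ := h r P' Γ' hr
    obtain ⟨Q, Δ, hQ, f⟩ := h s Q' Δ' hs
    exact (hN.pending_disjoint r P Γ s Q Δ hrs hP hQ).mono (by simpa using e.pending)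
      (by simpa using f.pending)

/-- One role moves, and the new indexes occur neither in this role nor in code that is on its way to
it; indexes that become pending occur nowhere. -/
theorem Net.Separated.update {N : Net S} (hN : N.Separated) {r : S.Role} {P P' : Proc S}
    {Γ Γ' : Store S} {A : Set ℕ} {B : Set (S.Role × ℕ)} (hr : N r = some (P, Γ))
    (h : Extends P P' A B)
    (hA : ∀ m ∈ A, ∀ s Q Δ, N s = some (Q, Δ) → (r, m) ∉ Q.pending)
    (hB : ∀ p ∈ B, p.1 ≠ r ∧ ∀ s Q Δ, N s = some (Q, Δ) → p.2 ∉ Q.indexes) :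
    Net.Separated (N.update r (P', Γ')) := by
  have key : ∀ s Q Δ, N.update r (P', Γ') s = some (Q, Δ) →
      (s = r ∧ Q = P') ∨ (s ≠ r ∧ N s = some (Q, Δ)) := by
    intro s Q Δ hs
    by_cases hsr : s = r
    · subst hsr
      simp only [Net.update_self, Option.some.injEq, Prod.mk.injEq] at hs
      exact .inl ⟨rfl, hs.1.symm⟩
    · rw [Net.update_of_ne hsr] at hs
      exact .inr ⟨hsr, hs⟩
  have hdisj : ∀ s Q Δ, r ≠ s → N s = some (Q, Δ) →
      _root_.Disjoint P'.pending Q.pending := by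
    intro s Q Δ hrs hs
    refine Set.disjoint_left.2 fun p hp hq => ?_
    rcases h.pending hp with hp | hp
    · exact Set.disjoint_left.1 (hN.pending_disjoint r P Γ s Q Δ hrs hr hs) hp hq
    · exact (hB p hp).2 s Q Δ hs (Proc.mem_indexes_of_mem_pending hq)
  constructor
  · intro s Q Δ hs
    rcases key s Q Δ hs with ⟨rfl, rfl⟩ | ⟨-, hs⟩
    · exact h.separated
    · exact hN.separated s Q Δ hs
  · intro s Q Δ t Q' Δ' m hs₁ ht₁ hm hm'
    rcases key s Q Δ hs₁ with ⟨rfl, rfl⟩ | ⟨hsr, hs⟩ <;>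
      rcases key t Q' Δ' ht₁ with ⟨rfl, rfl⟩ | ⟨htr, ht⟩
    · rcases h.pending hm with hm | hm
      · rcases h.indexes hm' with hm' | hm'
        · exact hN.pending_fresh _ P Γ _ P Γ m hr hr hm hm'
        · exact hA m hm' _ P Γ hr hm
      · exact (hB _ hm).1 rfl
    · rcases h.pending hm with hm | hm
      · exact hN.pending_fresh _ P Γ _ Q' Δ' m hr ht hm hm'
      · exact (hB _ hm).2 _ _ _ ht hm'
    · rcases h.indexes hm' with hm' | hm'
      · exact hN.pending_fresh _ Q Δ _ P Γ m hs hr hm hm'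
      · exact hA m hm' _ Q Δ hs hm
    · exact hN.pending_fresh _ Q Δ _ Q' Δ' m hs ht hm hm'
  · intro s Q Δ t Q' Δ' hst hs₁ ht₁
    rcases key s Q Δ hs₁ with ⟨rfl, rfl⟩ | ⟨hsr, hs⟩ <;>
      rcases key t Q' Δ' ht₁ with ⟨rfl, rfl⟩ | ⟨htr, ht⟩
    · exact absurd rfl hst
    · exact hdisj t Q' Δ' hst ht
    · exact (hdisj s Q Δ hst.symm hs).symm
    · exact hN.pending_disjoint s Q Δ t Q' Δ' hst hs ht

theorem Net.Separated.roleStep {N : Net S} (hN : N.Separated) {r : S.Role} {P P' : Proc S}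
    {Γ Γ' : Store S} {δ : Label S} (hr : N r = some (P, Γ)) (h : RoleStep r P Γ δ P' Γ')
    (hδ : δ.Admissible) (hA : δ.newIndexes = ∅) :
    Net.Separated (N.update r (P', Γ')) := by
  refine hN.update hr (h.extends (hN.separated r P Γ hr) hδ (by simp [hA])) (by simp [hA])
    fun p hp => ?_
  simpa [hA] using Label.mem_newIndexes_of_mem_newPending hp

theorem Net.Separated.netStep {N N' : Net S} {η : Label S} (hN : N.Separated)
    (h : NetStep N η N') (hη : η.IsTraceLabel) : N'.Separated := by
  cases h with
  | @role _ r P P' Γ Γ' _ hr h ht hup =>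
    cases η with
    | update J =>
      obtain ⟨hJ, hfresh⟩ := hup J rfl
      refine hN.update hr (h.extends (hN.separated r P Γ hr) hJ ?_) ?_ ?_
      · exact Set.disjoint_left.2 fun m hm => hfresh m hm r P Γ hr
      · exact fun m hm s Q Δ hs hm' =>
          hfresh m hm s Q Δ hs (Proc.mem_indexes_of_mem_pending hm')
      · exact fun p hp => ⟨hp.1, fun s Q Δ hs => hfresh _ hp.2 s Q Δ hs⟩
    | recvHO => exact hη.elim
    | _ => exact hN.roleStep hr h trivial rfl
  | tick h =>
    refine hN.mono fun r P' Γ' h' => ?_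
    rcases h r with ⟨-, e⟩ | ⟨P, Γ, P'', Γ'', e, e', hs⟩
    · simp [e] at h'
    · obtain ⟨rfl, rfl⟩ : P'' = P' ∧ Γ'' = Γ' := by simpa [e'] using h'
      exact ⟨P, Γ, e, hs.extends (hN.separated r P Γ e) trivial (by simp [Label.newIndexes])⟩
  | changeUpdates => exact hN
  | comm hst hs ht h₁ h₂ =>
    exact (hN.roleStep hs h₁ trivial rfl).roleStep
      (by rwa [Net.update_of_ne hst.symm]) h₂ trivial rfl
  | @commHO _ s t r₁ r₂ P P' Q Q' Γ Γ' Δ Δ' o X hst hs ht h₁ h₂ =>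
    have hM := hN.roleStep hs h₁ trivial rfl
    have ht' : N.update s (P', Γ') t = some (Q, Δ) := by
      rwa [Net.update_of_ne hst.symm]
    cases X with
    | none => exact hM.roleStep ht' h₂ trivial rfl
    | some X =>
      obtain rfl := h₂.recvHO_role
      obtain ⟨hX, hpend⟩ := h₁.sendHO_code (hN.separated s P Γ hs)
      refine hM.update ht' (h₂.extends (hN.separated _ Q Δ ht) hX ?_) ?_ (fun p hp => hp.elim)
      · exact Set.disjoint_left.2 fun m hm =>
          hN.pending_fresh s P Γ _ Q Δ m hs ht (hpend m hm).1
      · intro m hm s' R Θ hs' hm'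
        by_cases hss : s' = s
        · subst hss
          simp only [Net.update_self, Option.some.injEq, Prod.mk.injEq] at hs'
          exact (hpend m hm).2 (hs'.1 ▸ hm')
        · rw [Net.update_of_ne hss] at hs'
          exact Set.disjoint_left.1 (hN.pending_disjoint s P Γ s' R Θ (Ne.symm hss) hs hs')
            (hpend m hm).1 hm'

theorem separated_proj {I : AnnChoreo S} (hI : I.erase.Connected) (hwell : I.WellAnnotated)
    (G : GlobalState S) : (proj I G).Separated := by
  have hinj : Function.Injective (Op.user : UserOp S → Op S) := fun _ _ h => by cases h; rfl
  have key : ∀ s P Γ, proj I G s = some (P, Γ) → P = projRole (I.map Op.user id) s := by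
    intro s P Γ h
    simp only [proj, Option.ite_none_right_eq_some, Option.some.injEq, Prod.mk.injEq] at h
    exact h.2.1.symm
  constructor
  · intro s P Γ h
    rw [key s P Γ h]
    apply separated_projRole
    · rw [Dioc.parSeparated_map_iff hinj]
      exact (Dioc.parSeparated_map_iff Function.injective_id _ I).1 hI.parSeparated
    · rwa [Dioc.annotations_map]
    · rw [Dioc.operations_map]
      rintro _ ⟨p, -, rfl⟩ m hm
      exact hm.elim
  · intro r P Γ s Q Δ m hr _ hm
    rw [key r P Γ hr, pending_projRole] at hm
    exact hm.elim
  · intro r P Γ s Q Δ _ hr _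
    simp [key r P Γ hr, pending_projRole]

/-! ### Absence of races -/

/-- The endpoint that an active occurrence of a send or of a receive offers.  The scope of a role that
is not the coordinator receives a higher-order message. -/
inductive Offers : Proc S → Endpoint S → Prop
  | recv (o : Op S) (x : PVar S) (r : S.Role) : Offers (.recv o x r) (.recv o r)
  | send (o : Op S) (e : S.Expr) (r : S.Role) : Offers (.send o e r) (.send o r)
  | sendProc (o : Op S) (X : Proc S) (r : S.Role) : Offers (.sendProc o X r) (.send o r)
  | sendNo (o : Op S) (r : S.Role) : Offers (.sendNo o r) (.send o r)
  | scopeFollow (n : ℕ) (r : S.Role) (P : Proc S) : Offers (.scopeFollow n r P) (.recv (.aux n) r)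

theorem Active.mem_endpoints {r : S.Role} {Γ : Store S} {P A : Proc S} {p : List Side}
    {k : Endpoint S} (h : Active r Γ P p A) (hk : Offers A k) : k ∈ P.endpoints := by
  induction h with
  | here P => cases hk <;> simp [Proc.endpoints, Endpoint.op, Op.indexes]
  | seqLeft _ ih | parLeft _ ih => exact .inl (ih hk)
  | seqRight _ _ ih | parRight _ ih => exact .inr (ih hk)

theorem Active.unique {r : S.Role} {Γ : Store S} {P A B : Proc S} {p : List Side}
    (hA : Active r Γ P p A) (hB : Active r Γ P p B) : A = B := by
  induction hA with
  | here => cases hB; rfl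
  | seqLeft _ ih | seqRight _ _ ih | parLeft _ ih | parRight _ ih =>
    cases hB
    apply ih
    assumption

/-- A process that can terminate has no active sends or receives; so the two sides of a sequential
composition are never active together. -/
theorem RoleStep.not_active_of_tick {r : S.Role} {Γ Γ' : Store S} {P P' A : Proc S}
    {p : List Side} {k : Endpoint S} (h : RoleStep r P Γ .tick P' Γ') (hk : Offers A k) :
    ¬ Active r Γ P p A := by
  intro hA
  induction hA generalizing P' Γ' with
  | here => cases hk <;> cases h
  | seqLeft _ ih =>
    cases h with
    | seq _ h => exact h rfl
    | seqEnd h _ => exact ih h hk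
  | seqRight _ _ ih =>
    cases h with
    | seq _ h => exact h rfl
    | seqEnd _ h => exact ih h hk
  | parLeft _ ih =>
    cases h with
    | parLeft _ h | parRight _ h => exact h rfl
    | parEnd h _ => exact ih h hk
  | parRight _ ih =>
    cases h with
    | parLeft _ h | parRight _ h => exact h rfl
    | parEnd _ h => exact ih h hk

theorem Proc.Separated.position_unique {r : S.Role} {Γ : Store S} {P A B : Proc S}
    {p q : List Side} {k : Endpoint S} (hP : P.Separated) (hA : Active r Γ P p A)
    (hB : Active r Γ P q B) (hAk : Offers A k) (hBk : Offers B k) : p = q := by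
  induction hA generalizing q with
  | here => cases hAk <;> cases hB <;> rfl
  | seqLeft hA ih =>
    cases hB with
    | here => cases hBk
    | seqLeft hB => rw [ih hP.1 hB hAk]
    | seqRight ht _ => exact absurd hA (ht.not_active_of_tick hAk)
  | seqRight ht _ ih =>
    cases hB with
    | here => cases hBk
    | seqLeft hB => exact absurd hB (ht.not_active_of_tick hBk)
    | seqRight _ hB => rw [ih hP.2.1 hB hAk]
  | parLeft hA ih =>
    cases hB with
    | here => cases hBk
    | parLeft hB => rw [ih hP.1 hB hAk]
    | parRight hB =>
      exact absurd (hB.mem_endpoints hBk) (Set.disjoint_left.1 hP.2.2.2 (hA.mem_endpoints hAk))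
  | parRight hA ih =>
    cases hB with
    | here => cases hBk
    | parLeft hB =>
      exact absurd (hA.mem_endpoints hAk) (Set.disjoint_left.1 hP.2.2.2 (hB.mem_endpoints hBk))
    | parRight hB => rw [ih hP.2.1 hB hAk]

theorem Complementary.offers {r₁ r₂ : S.Role} {A B : Proc S} (h : Complementary r₁ r₂ A B) :
    ∃ o, Offers A (.send o r₂) ∧ Offers B (.recv o r₁) := by
  cases h with
  | value o e x => exact ⟨o, .send .., .recv ..⟩
  | code n X P => exact ⟨.aux n, .sendProc .., .scopeFollow ..⟩
  | no n P => exact ⟨.aux n, .sendNo .., .scopeFollow ..⟩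

theorem Offers.unique {A : Proc S} {k k' : Endpoint S} (h : Offers A k) (h' : Offers A k') :
    k = k' := by
  cases h <;> cases h' <;> rfl

theorem Net.Separated.raceFree {N : Net S} (hN : N.Separated) : N.RaceFree := by
  constructor
  · rintro r₁ p r₁' p' r₂ q ⟨-, P₁, Γ₁, P₂, Γ₂, A, B, e₁, e₂, hA, hB, h⟩
      ⟨-, P₁', Γ₁', P₂', Γ₂', A', B', e₁', e₂', hA', hB', h'⟩
    obtain ⟨rfl, rfl⟩ : P₂ = P₂' ∧ Γ₂ = Γ₂' := by simpa [e₂] using e₂'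
    obtain rfl := hB.unique hB'
    obtain ⟨o, hAo, hBo⟩ := h.offers
    obtain ⟨o', hAo', hBo'⟩ := h'.offers
    cases hBo.unique hBo'
    obtain ⟨rfl, rfl⟩ : P₁ = P₁' ∧ Γ₁ = Γ₁' := by simpa [e₁] using e₁'
    exact ⟨rfl, (hN.separated _ _ _ e₁).position_unique hA hA' hAo hAo'⟩
  · rintro r₁ p r₂ q r₂' q' ⟨-, P₁, Γ₁, P₂, Γ₂, A, B, e₁, e₂, hA, hB, h⟩
      ⟨-, P₁', Γ₁', P₂', Γ₂', A', B', e₁', e₂', hA', hB', h'⟩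
    obtain ⟨rfl, rfl⟩ : P₁ = P₁' ∧ Γ₁ = Γ₁' := by simpa [e₁] using e₁'
    obtain rfl := hA.unique hA'
    obtain ⟨o, hAo, hBo⟩ := h.offers
    obtain ⟨o', hAo', hBo'⟩ := h'.offers
    cases hAo.unique hAo'
    obtain ⟨rfl, rfl⟩ : P₂ = P₂' ∧ Γ₂ = Γ₂' := by simpa [e₂] using e₂'
    exact ⟨rfl, (hN.separated _ _ _ e₂).position_unique hB hB' hBo hBo'⟩

end DynChor

open DynChor in
theorem corollary3 {S : Sig} (I : Choreo S) (hinit : I.Initial) (hconn : I.Connected)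
    (Ia : AnnChoreo S) (hann : Ia.erase = I) (hwell : Ia.WellAnnotated)
    (G : GlobalState S) (U : Set (Choreo S))
    (U' : Set (Choreo S)) (N : Net S) (hreach : Reaches U (proj Ia G) U' N) :
    N.RaceFree := by
  subst hann
  suffices ∀ B : Set (Choreo S) × Net S, Relation.ReflTransGen
      (fun A B : Set (Choreo S) × Net S => ∃ η : Label S, η.IsTraceLabel ∧ Step A.1 A.2 η B.1 B.2)
      (U, proj Ia G) B → B.2.Separated from (this _ hreach).raceFree
  intro B hB
  induction hB with
  | refl => exact separated_proj hconn hwell G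
  | tail _ h ih =>
    obtain ⟨η, hη, hstep⟩ := h
    exact ih.netStep hstep.netStep hη
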